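/- Let $\mathbb{X}_{\mathrm{L}}\subset\{0,1\}^{\mathbb{Z}^2}$ be Ledrappier's shift, the set of all $x$ with $x_{(m,n)}+x_{(m+1,n)}+x_{(m,n+1)}\equiv 0 \bmod 2$ for all $m,n\in\mathbb{Z}$, with the product topology and the shifts $(S^{v}x)_{u}=x_{u+v}$, $u,v\in\mathbb{Z}^2$. Let $\mathrm{Aut}(\mathbb{X}_{\mathrm{L}})$ be the group of all self-homeomorphisms of $\mathbb{X}_{\mathrm{L}}$ and $\mathcal{G}=\{S^{v}\mid v\in\mathbb{Z}^2\}\subset\mathrm{Aut}(\mathbb{X}_{\mathrm{L}})$ the group of shifts. The symmetry group $\mathcal{S}(\mathbb{X}_{\mathrm{L}})$ is the centraliser of $\mathcal{G}$ in $\mathrm{Aut}(\mathbb{X}_{\mathrm{L}})$, and the extended symmetry group $\mathcal{R}(\mathbb{X}_{\mathrm{L}})$ is its normaliser. For $M\in\mathrm{GL}(2,\mathbb{Z})$, let $(h_M x)_{u}=x_{M^{-1}u}$. Let $D_3\subset\mathrm{GL}(2,\mathbb{Z})$ be the group of all matrices that preserve the set of elementary $L$-triangles $\{(m,n),(m+1,n),(m,n+1)\}$,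 $m,n\in\mathbb{Z}$. Then the following holds. (1) The map $v\mapsto S^{v}$ is injective and $\mathcal{S}(\mathbb{X}_{\mathrm{L}})=\mathcal{G}$, so $\mathcal{S}(\mathbb{X}_{\mathrm{L}})=\mathbb{Z}^2$. (2) $D_3$ consists precisely of the six matrices $$\begin{pmatrix}1&0\\0&1\end{pmatrix},\ \begin{pmatrix}0&1\\1&0\end{pmatrix},\ \begin{pmatrix}-1&-1\\0&1\end{pmatrix},\ \begin{pmatrix}0&1\\-1&-1\end{pmatrix},\ \begin{pmatrix}1&0\\-1&-1\end{pmatrix},\ \begin{pmatrix}-1&-1\\1&0\end{pmatrix},$$ and it is isomorphic to the dihedral group with $6$ elements, $D_3\simeq C_3\rtimes C_2$. (3) For $M\in\mathrm{GL}(2,\mathbb{Z})$, there is an $H\in\mathcal{R}(\mathbb{X}_{\mathrm{L}})$ with $HS^{v}H^{-1}=S^{Mv}$ for all $v\in\mathbb{Z}^2$ if and only if $M\in D_3$. (4) $\mathcal{R}(\mathbb{X}_{\mathrm{L}})=\mathbb{Z}^2\rtimes D_3$, where $D_3$ acts on $\mathbb{Z}^2$ linearly: the map $(v,M)\mapsto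 S^{v}h_M$ is a group isomorphism from $\mathbb{Z}^2\rtimes D_3$ onto $\mathcal{R}(\mathbb{X}_{\mathrm{L}})$. -/

import Mathlib

namespace ZdShift

open Matrix SymbolicDynamics.FullShift

/-- Configurations on the lattice `ℤ^d` over the alphabet `A`. -/
abbrev Config (d : ℕ) (A : Type*) : Type _ := (Fin d → ℤ) → A

/-- The topological space underlying a `ℤ^d`-shift (subspace of the product space). -/
abbrev Space {d : ℕ} {A : Type*} [TopologicalSpace A] (X : Subshift A (Fin d → ℤ)) : Type _ :=
  X.carrier

/-- `Aut (X)`: the group of all self-homeomorphisms of the space `X`, under composition. -/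
abbrev AutGroup {d : ℕ} {A : Type*} [TopologicalSpace A] (X : Subshift A (Fin d → ℤ)) : Type _ :=
  Space X ≃ₜ Space X

/-- The shift `S^v = ∏ i, S_i ^ (v i)`, with `(S^v x) u = x (v + u)`, as a homeomorphism of `X`. -/
def shiftHomeo {d : ℕ} {A : Type*} [TopologicalSpace A] (X : Subshift A (Fin d → ℤ))
    (v : Fin d → ℤ) : AutGroup X where
  toFun x := ⟨shift v x.1, X.mapsTo v x.2⟩
  invFun x := ⟨shift (-v) x.1, X.mapsTo (-v) x.2⟩
  left_inv x := by
    apply Subtype.ext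
    funext u
    simp [shift_apply]
  right_inv x := by
    apply Subtype.ext
    funext u
    simp [shift_apply]
  continuous_toFun := by fun_prop
  continuous_invFun := by fun_prop

/-- The shift action of `ℤ^d` on `X`, as a homomorphism `v ↦ S^v` into `Aut (X)`. -/
def shiftHom {d : ℕ} {A : Type*} [TopologicalSpace A] (X : Subshift A (Fin d → ℤ)) :
    Multiplicative (Fin d → ℤ) →* AutGroup X where
  toFun v := shiftHomeo X v.toAdd
  map_one' := by
    apply Homeomorph.ext
    intro x
    apply Subtype.ext
    funext u
    simp [shiftHomeo]
  map_mul' v w := by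
    apply Homeomorph.ext
    intro x
    apply Subtype.ext
    funext u
    simp [shiftHomeo, shift_apply, add_assoc, add_left_comm]

/-- The group `𝒢 = ⟨S_1, …, S_d⟩ ≤ Aut (X)` of all shifts of `X`. -/
def shiftGroup {d : ℕ} {A : Type*} [TopologicalSpace A] (X : Subshift A (Fin d → ℤ)) :
    Subgroup (AutGroup X) :=
  (shiftHom X).range

/-- The symmetry group `𝒮 (X)`: the centraliser of the shift group in `Aut (X)`. -/
def symmetryGroup {d : ℕ} {A : Type*} [TopologicalSpace A] (X : Subshift A (Fin d → ℤ)) :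
    Subgroup (AutGroup X) :=
  Subgroup.centralizer (shiftGroup X : Set (AutGroup X))

/-- The extended symmetry group `ℛ (X)`: the normaliser of the shift group in `Aut (X)`. -/
def extendedSymmetryGroup {d : ℕ} {A : Type*} [TopologicalSpace A]
    (X : Subshift A (Fin d → ℤ)) : Subgroup (AutGroup X) :=
  Subgroup.normalizer (shiftGroup X : Set (AutGroup X))

/-- `H` conjugates the shifts of `X` according to the matrix `M`, that is
`H S^v H⁻¹ = S^(M v)` for all `v`. -/
def ConjugatesShiftsBy {d : ℕ} {A : Type*} [TopologicalSpace A] (X : Subshift A (Fin d → ℤ))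
    (H : AutGroup X) (M : GL (Fin d) ℤ) : Prop :=
  ∀ v : Fin d → ℤ, H * shiftHomeo X v * H⁻¹ = shiftHomeo X (M.val *ᵥ v)

/-- The coordinate transformation `h_M` on configurations, `(h_M x) u = x (M⁻¹ u)`. -/
def coordMap {d : ℕ} {A : Type*} (M : GL (Fin d) ℤ) (x : Config d A) : Config d A :=
  fun u => x ((M⁻¹).val *ᵥ u)

/-- The linear action of `GL (d, ℤ)` on `ℤ^d` by group automorphisms. -/
def linearAction (d : ℕ) : GL (Fin d) ℤ →* MulAut (Multiplicative (Fin d → ℤ)) where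
  toFun M :=
    { toFun := fun v => Multiplicative.ofAdd (M.val *ᵥ v.toAdd)
      invFun := fun v => Multiplicative.ofAdd ((M⁻¹).val *ᵥ v.toAdd)
      left_inv := fun v => by simp [Matrix.mulVec_mulVec, ← Units.val_mul, -coe_units_inv]
      right_inv := fun v => by simp [Matrix.mulVec_mulVec, ← Units.val_mul, -coe_units_inv]
      map_mul' := fun v w => by simp [Matrix.mulVec_add] }
  map_one' := by
    ext v
    simp
  map_mul' M N := by
    apply MulEquiv.ext
    intro v
    simp [Matrix.mulVec_mulVec]

/-- Ledrappier's shift: all `x ∈ {0,1}^(ℤ²)` with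
`x (m, n) + x (m + 1, n) + x (m, n + 1) ≡ 0 mod 2` for all `m, n`. -/
def ledrappier : Subshift (ZMod 2) (Fin 2 → ℤ) where
  carrier := {x | ∀ m n : ℤ, x ![m, n] + x ![m + 1, n] + x ![m, n + 1] = 0}
  isClosed := by
    simp only [Set.ofPred_forall]
    refine isClosed_iInter fun m => isClosed_iInter fun n => ?_
    exact isClosed_eq (by fun_prop) continuous_const
  mapsTo v x hx m n := by
    have h := hx (v 0 + m) (v 1 + n)
    have e : ∀ a b : ℤ, v + ![a, b] = ![v 0 + a, v 1 + b] := by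
      intro a b
      ext i
      fin_cases i <;> simp
    simpa [shift_apply, e, add_assoc] using h

/-- The elementary `L`-triangles, given by their vertex sets
`{(m, n), (m + 1, n), (m, n + 1)}`. -/
def elementaryTriangles : Set (Set (Fin 2 → ℤ)) :=
  {T | ∃ m n : ℤ, T = {![m, n], ![m + 1, n], ![m, n + 1]}}

/-- The group of all matrices in `GL (2, ℤ)` that preserve the pattern of the
elementary `L`-triangles. -/
def D3 : Subgroup (GL (Fin 2) ℤ) where
  carrier := {M | ∀ T : Set (Fin 2 → ℤ),
    T ∈ elementaryTriangles ↔ (fun v => M.val *ᵥ v) '' T ∈ elementaryTriangles}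
  one_mem' := by
    intro T
    simp
  mul_mem' := by
    intro M N hM hN T
    rw [hN T, hM, Set.image_image]
    simp only [Matrix.mulVec_mulVec, Units.val_mul]
  inv_mem' := by
    intro M hM T
    rw [hM ((fun v => (M⁻¹).val *ᵥ v) '' T), Set.image_image]
    simp only [Matrix.mulVec_mulVec, ← Units.val_mul, mul_inv_cancel, Units.val_one,
      Matrix.one_mulVec, Set.image_id']

end ZdShift

/-!
*Symmetries.* By compactness a symmetry `H` of Ledrappier's shift has a local rule with a finite
window. In characteristic two the defining relation holds at every scale `q = 2 ^ k`, that is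
`S^(0,q) = 1 + S^(q,0)`. Rows of points are arbitrary and determine everything above them, so the
windows at `0` and at `(q, 0)` can be filled independently once `q` is large, and comparing the
local rule at `0`, `(q, 0)` and `(0, q)` shows that `H` is additive
(`map_add_of_mem_symmetryGroup`). Write `X` for the horizontal shift; the vertical shift is `1 + X`.
A linear symmetry is, up to a shift, a polynomial in `X` over the field with two elements. Applying
this to `H` and `H⁻¹` gives polynomials with product `X ^ n * (1 + X) ^ n`, and unique factorisation
forces `H` to be a monomial in `X` and `1 + X`, that is, a shift (`symmetryGroup_ledrappier`).

*Extended symmetries.* The shift action is faithful, so conjugation by an extended symmetry `H` is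
given by some `M` in `GL (2, ℤ)`. A half-plane determines the points of the shift completely unless
its inner normal is a nonnegative multiple of one of the inner edge normals `(1, 0)`, `(0, 1)`,
`(-1, -1)` of the elementary triangles (`edgeNormal_of_zero_halfPlane`), while Pascal's triangle
modulo two vanishes on a coordinate half-plane without vanishing identically. As `H` has a local
rule, it carries half-planes failing to determine a point to half-planes of the same kind, so both
rows of `M⁻¹` are multiples of edge normals; invertibility leaves exactly the six matrices of the
triangle group (`ConjugatesShiftsBy.mem_D3`). Conversely each of these acts by `h_M`, and
`H * h_M⁻¹` is a symmetry, hence a shift, which yields the semidirect product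
(`range_semidirectHom`).
-/

namespace ZdShift

open Matrix SymbolicDynamics.FullShift Polynomial

/-! ### Local rules -/

/-- Continuous maps from a subshift over a finite alphabet to a discrete space depend on finitely
many coordinates only (Curtis–Hedlund–Lyndon). -/
theorem exists_finset_forall_eq_of_continuous {d : ℕ} {A B : Type*} [TopologicalSpace A]
    [DiscreteTopology A] [Finite A] [TopologicalSpace B] [DiscreteTopology B]
    (X : Subshift A (Fin d → ℤ)) {g : Space X → B} (hg : Continuous g) :
    ∃ W : Finset (Fin d → ℤ), ∀ x y : Space X, (∀ w ∈ W, x.1 w = y.1 w) → g x = g y := by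
  have : CompactSpace (Space X) := isCompact_iff_compactSpace.1 X.isClosed.isCompact
  have key : ∃ W : Finset (Fin d → ℤ), ∀ x ∈ (Set.univ : Set (Space X)), ∀ y : Space X,
      (∀ w ∈ W, x.1 w = y.1 w) → g x = g y := by
    refine isCompact_univ.induction_on
      (p := fun s : Set (Space X) => ∃ W : Finset (Fin d → ℤ), ∀ x ∈ s, ∀ y : Space X,
        (∀ w ∈ W, x.1 w = y.1 w) → g x = g y) ⟨∅, by simp⟩ ?_ ?_ ?_
    · rintro s t hst ⟨W, hW⟩
      exact ⟨W, fun x hx => hW x (hst hx)⟩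
    · classical
      rintro s t ⟨W, hW⟩ ⟨W', hW'⟩
      refine ⟨W ∪ W', ?_⟩
      rintro x (hx | hx) y h
      · exact hW x hx y fun w hw => h w (Finset.mem_union_left _ hw)
      · exact hW' x hx y fun w hw => h w (Finset.mem_union_right _ hw)
    · intro x _
      obtain ⟨U, hU, hUg⟩ := isOpen_induced_iff.1 ((isOpen_discrete {g x}).preimage hg)
      have hxU : x.1 ∈ U := by
        have : x ∈ Subtype.val ⁻¹' U := by rw [hUg]; rfl
        exact this
      obtain ⟨W, u, hu, hWU⟩ := isOpen_pi_iff.1 hU x.1 hxU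
      have hcyl : ∀ y : Space X, (∀ w ∈ W, y.1 w = x.1 w) → g y = g x := by
        intro y hy
        have : y ∈ Subtype.val ⁻¹' U := hWU fun w hw => by
          rw [hy w hw]; exact (hu w hw).2
        rw [hUg] at this
        exact this
      refine ⟨{y | ∀ w ∈ W, y.1 w = x.1 w}, ?_, W, ?_⟩
      · rw [nhdsWithin_univ]
        have hopen : IsOpen {y : Space X | ∀ w ∈ W, y.1 w = x.1 w} := by
          have : {y : Space X | ∀ w ∈ W, y.1 w = x.1 w}
              = ⋂ w ∈ W, (fun y : Space X => y.1 w) ⁻¹' {x.1 w} := by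
            ext y; simp
          rw [this]
          exact isOpen_biInter_finset fun w _ => (isOpen_discrete _).preimage
            ((continuous_apply w).comp continuous_subtype_val)
        exact hopen.mem_nhds fun _ _ => rfl
      · intro y hy z hz
        rw [hcyl y hy, hcyl z fun w hw => (hz w hw).symm.trans (hy w hw)]
  obtain ⟨W, hW⟩ := key
  exact ⟨W, fun x y => hW x (Set.mem_univ x) y⟩

/-- Every finite set of lattice points lies in a box. -/
theorem exists_forall_abs_le {d : ℕ} (W : Finset (Fin d → ℤ)) :
    ∃ L : ℕ, ∀ w ∈ W, ∀ i, |w i| ≤ L := by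
  refine ⟨∑ w ∈ W, ∑ i, (w i).natAbs, fun w hw i => ?_⟩
  have h1 : (w i).natAbs ≤ ∑ i, (w i).natAbs :=
    Finset.single_le_sum (f := fun i => (w i).natAbs) (fun _ _ => Nat.zero_le _)
      (Finset.mem_univ i)
  have h2 : ∑ i, (w i).natAbs ≤ ∑ w ∈ W, ∑ i, (w i).natAbs :=
    Finset.single_le_sum (f := fun w : Fin d → ℤ => ∑ i, (w i).natAbs)
      (fun _ _ => Nat.zero_le _) hw
  rw [Int.abs_eq_natAbs]
  exact_mod_cast h1.trans h2

theorem shiftHomeo_apply {d : ℕ} {A : Type*} [TopologicalSpace A] (X : Subshift A (Fin d → ℤ))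
    (v : Fin d → ℤ) (x : Space X) (u : Fin d → ℤ) : (shiftHomeo X v x).1 u = x.1 (v + u) := by
  simp [shiftHomeo, shift_apply]

theorem shiftHomeo_add {d : ℕ} {A : Type*} [TopologicalSpace A] (X : Subshift A (Fin d → ℤ))
    (v w : Fin d → ℤ) : shiftHomeo X (v + w) = shiftHomeo X v * shiftHomeo X w :=
  (shiftHom X).map_mul (.ofAdd v) (.ofAdd w)

theorem shiftHomeo_zero {d : ℕ} {A : Type*} [TopologicalSpace A] (X : Subshift A (Fin d → ℤ)) :
    shiftHomeo X 0 = 1 :=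
  (shiftHom X).map_one

theorem shiftHomeo_neg {d : ℕ} {A : Type*} [TopologicalSpace A] (X : Subshift A (Fin d → ℤ))
    (v : Fin d → ℤ) : shiftHomeo X (-v) = (shiftHomeo X v)⁻¹ :=
  (shiftHom X).map_inv (.ofAdd v)

theorem mem_shiftGroup {d : ℕ} {A : Type*} [TopologicalSpace A] {X : Subshift A (Fin d → ℤ)}
    {H : AutGroup X} : H ∈ shiftGroup X ↔ ∃ v, H = shiftHomeo X v :=
  ⟨fun ⟨v, hv⟩ => ⟨v.toAdd, hv.symm⟩, fun ⟨v, hv⟩ => ⟨.ofAdd v, hv.symm⟩⟩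

/-! ### Points of Ledrappier's shift -/

theorem vec_add (a b c d : ℤ) : (![a, b] + ![c, d] : Fin 2 → ℤ) = ![a + c, b + d] := by
  simp

theorem eq_vec (u : Fin 2 → ℤ) : u = ![u 0, u 1] := by
  ext i; fin_cases i <;> rfl

theorem ledrappier_up {x : Config 2 (ZMod 2)} (hx : x ∈ ledrappier.carrier) (m n : ℤ) :
    x ![m, n + 1] = x ![m, n] + x ![m + 1, n] := by
  have h := hx m n
  rw [add_comm, CharTwo.add_eq_zero] at h
  exact h

/-- Ledrappier's shift as a vector space over the field with two elements. -/
def ledrappierSubmodule : Submodule (ZMod 2) (Config 2 (ZMod 2)) where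
  carrier := ledrappier.carrier
  zero_mem' := by intro m n; simp
  add_mem' := by
    intro x y hx hy m n
    have h := congrArg₂ (· + ·) (hx m n) (hy m n)
    simp only [Pi.add_apply, add_zero] at h ⊢
    rw [← h]; ring
  smul_mem' := by
    intro c x hx m n
    have h := congrArg (c * ·) (hx m n)
    simp only [Pi.smul_apply, smul_eq_mul, mul_zero] at h ⊢
    rw [← h]; ring

/-- The elementary triangle relation holds at every dyadic scale, because
`(1 + s) ^ (2 ^ k) = 1 + s ^ (2 ^ k)` in characteristic two. -/
theorem ledrappier_up_two_pow {x : Config 2 (ZMod 2)} (hx : x ∈ ledrappier.carrier) (k : ℕ) :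
    ∀ m n : ℤ, x ![m, n + 2 ^ k] = x ![m, n] + x ![m + 2 ^ k, n] := by
  induction k with
  | zero => simpa using ledrappier_up hx
  | succ k ih =>
    intro m n
    have e : ∀ a : ℤ, a + 2 ^ (k + 1) = a + 2 ^ k + 2 ^ k := fun a => by ring
    rw [e, e, ih, ih, ih (m + 2 ^ k) n, add_assoc, ← add_assoc (x ![m + 2 ^ k, n]),
      CharTwo.add_self_eq_zero, zero_add]

/-- A segment of a row determines the triangle above it. -/
theorem ledrappier_eq_of_row {x y : Config 2 (ZMod 2)} (hx : x ∈ ledrappier.carrier)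
    (hy : y ∈ ledrappier.carrier) {a b n : ℤ} (h : ∀ m, a ≤ m → m ≤ b → x ![m, n] = y ![m, n])
    (j : ℕ) : ∀ m, a ≤ m → m + j ≤ b → x ![m, n + j] = y ![m, n + j] := by
  induction j with
  | zero => simpa using h
  | succ j ih =>
    intro m hm hmj
    push_cast at hmj ⊢
    rw [← add_assoc, ledrappier_up hx, ledrappier_up hy, ih m hm (by omega),
      ih (m + 1) (by omega) (by omega)]

/-- A preimage of the row `r` under `s ↦ (m ↦ s m + s (m + 1))`; one of the two sums is empty. -/
noncomputable def rowBelow (r : ℤ → ZMod 2) (m : ℤ) : ZMod 2 :=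
  ∑ i ∈ Finset.Ico 0 m, r i + ∑ i ∈ Finset.Ico m 0, r i

theorem rowBelow_add (r : ℤ → ZMod 2) (m : ℤ) : rowBelow r m + rowBelow r (m + 1) = r m := by
  unfold rowBelow
  rcases le_or_gt 0 m with h | h
  · rw [Finset.Ico_eq_empty (a := m) (by omega), Finset.Ico_eq_empty (a := m + 1) (by omega),
      ← Finset.insert_Ico_right_eq_Ico_add_one h,
      Finset.sum_insert (by simp)]
    simp only [Finset.sum_empty, add_zero]
    rw [add_left_comm, CharTwo.add_self_eq_zero, add_zero]
  · rw [Finset.Ico_eq_empty (b := m) (by omega), Finset.Ico_eq_empty (b := m + 1) (by omega),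
      ← Finset.insert_Ico_add_one_left_eq_Ico h, Finset.sum_insert (by simp)]
    simp only [Finset.sum_empty, zero_add]
    rw [add_assoc, CharTwo.add_self_eq_zero, add_zero]

/-- Any bi-infinite word occurs as row zero of some point of Ledrappier's shift. -/
theorem exists_ledrappier_row_zero (r : ℤ → ZMod 2) :
    ∃ x ∈ ledrappier.carrier, ∀ m, x ![m, 0] = r m := by
  let up : (ℤ → ZMod 2) → ℤ → ZMod 2 := fun s m => s m + s (m + 1)
  let row : ℤ → ℤ → ZMod 2 := fun n =>
    if 0 ≤ n then up^[n.toNat] r else rowBelow^[(-n).toNat] r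
  have hrow : ∀ n, row (n + 1) = up (row n) := by
    intro n
    rcases le_or_gt 0 n with h | h
    · simp only [row, if_pos h, if_pos (by omega : 0 ≤ n + 1)]
      rw [show (n + 1).toNat = n.toNat + 1 by omega, Function.iterate_succ_apply']
    · have e : (-n).toNat = (-(n + 1)).toNat + 1 := by omega
      have e' : row (n + 1) = rowBelow^[(-(n + 1)).toNat] r := by
        rcases eq_or_ne (n + 1) 0 with h0 | h0
        · simp [row, h0]
        · simp only [row, if_neg (by omega : ¬ 0 ≤ n + 1)]
      rw [e']
      simp only [row, if_neg (by omega : ¬ 0 ≤ n)]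
      rw [e, Function.iterate_succ_apply']
      funext m
      exact (rowBelow_add _ m).symm
  refine ⟨fun u => row (u 1) (u 0), fun m n => ?_, fun m => ?_⟩
  · simp only [cons_val_zero, cons_val_one, hrow, up]
    exact CharTwo.add_self_eq_zero _
  · simp [row]

theorem exists_ledrappier_row (r : ℤ → ZMod 2) (n : ℤ) :
    ∃ x ∈ ledrappier.carrier, ∀ m, x ![m, n] = r m := by
  obtain ⟨x, hx, hxr⟩ := exists_ledrappier_row_zero r
  refine ⟨shift ![0, -n] x, ledrappier.mapsTo _ hx, fun m => ?_⟩
  rw [shift_apply, vec_add]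
  simpa using hxr m

/-- Pascal's triangle modulo two: a point vanishing on the upper half-plane. -/
theorem exists_ledrappier_zero_above :
    ∃ x ∈ ledrappier.carrier, (∀ m n, 0 ≤ n → x ![m, n] = 0) ∧ ∀ m, x ![m, -1] = 1 := by
  let f : ℤ → ℤ → ZMod 2 := fun m n =>
    if 0 ≤ n then 0 else ((Ring.choose m (-n - 1).toNat : ℤ) : ZMod 2)
  have hf : ∀ m n, f m n + f (m + 1) n + f m (n + 1) = 0 := by
    intro m n
    simp only [f]
    rcases le_or_gt 0 n with h | h
    · simp [h, show 0 ≤ n + 1 by omega]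
    · rcases eq_or_ne n (-1) with rfl | h1
      · simp [CharTwo.add_self_eq_zero]
      · obtain ⟨k, rfl⟩ : ∃ k : ℕ, n = -k - 2 := ⟨(-n - 2).toNat, by omega⟩
        rw [if_neg (by omega), if_neg (by omega), if_neg (by omega),
          show (-(-(k : ℤ) - 2) - 1).toNat = k + 1 by omega,
          show (-(-(k : ℤ) - 2 + 1) - 1).toNat = k by omega, Ring.choose_succ_succ]
        push_cast
        generalize ((Ring.choose m k : ℤ) : ZMod 2) = a
        generalize ((Ring.choose m (k + 1) : ℤ) : ZMod 2) = b
        revert a b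
        decide
  exact ⟨fun u => f (u 0) (u 1), hf, fun m n h => if_pos h, fun m => by simp [f]⟩

theorem ledrappier_transpose {x : Config 2 (ZMod 2)} (hx : x ∈ ledrappier.carrier) :
    (fun u : Fin 2 → ℤ => x ![u 1, u 0]) ∈ ledrappier.carrier := by
  intro m n
  have := hx n m
  simp only [cons_val_zero, cons_val_one]
  rw [← this]; ring

/-- Each coordinate half-plane `0 ≤ u i` is the zero set of a nonzero point, which moreover
has no zero on the adjacent line `u i = -1`. -/
theorem exists_ledrappier_zero_halfPlane (i : Fin 2) :
    ∃ x ∈ ledrappier.carrier, (∀ u : Fin 2 → ℤ, 0 ≤ u i → x u = 0) ∧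
      ∀ u : Fin 2 → ℤ, u i = -1 → x u = 1 := by
  obtain ⟨x, hx, h0, h1⟩ := exists_ledrappier_zero_above
  fin_cases i
  · refine ⟨_, ledrappier_transpose hx, fun u hu => h0 _ _ hu, fun u hu => ?_⟩
    have hu : u 0 = -1 := hu
    simp only [hu]
    exact h1 _
  · refine ⟨x, hx, fun u hu => ?_, fun u hu => ?_⟩
    · rw [eq_vec u]; exact h0 _ _ hu
    · have hu : u 1 = -1 := hu
      rw [eq_vec u, hu]; exact h1 _

theorem shiftHom_ledrappier_injective : Function.Injective (shiftHom ledrappier) := by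
  rw [injective_iff_map_eq_one]
  intro v hv
  have key : ∀ w : Fin 2 → ℤ, shiftHomeo ledrappier w = 1 → ∀ i, w i ≤ 0 := by
    intro w hw i
    obtain ⟨x, hx, h0, h1⟩ := exists_ledrappier_zero_halfPlane i
    by_contra! hi
    have h := shiftHomeo_apply ledrappier w ⟨x, hx⟩ (fun _ => -1)
    rw [hw] at h
    have h' : x (fun _ => -1) = x (w + fun _ => -1) := h
    rw [h1 _ rfl, h0 _ (by simp only [Pi.add_apply]; omega)] at h'
    exact one_ne_zero h'
  have hpos := key v.toAdd hv
  have hneg := key (-v.toAdd) (by rw [shiftHomeo_neg]; exact inv_eq_one.2 hv)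
  refine Multiplicative.toAdd.injective (funext fun i => ?_)
  have := hpos i
  have := hneg i
  simp only [Pi.neg_apply] at this
  change v.toAdd i = 0
  omega

theorem shiftHomeo_ledrappier_injective : Function.Injective (shiftHomeo ledrappier) :=
  fun v w h => Multiplicative.ofAdd.injective
    (shiftHom_ledrappier_injective (a₁ := .ofAdd v) (a₂ := .ofAdd w) h)

/-! ### Symmetries are linear -/

theorem mem_symmetryGroup {d : ℕ} {A : Type*} [TopologicalSpace A] {X : Subshift A (Fin d → ℤ)}
    {H : AutGroup X} :
    H ∈ symmetryGroup X ↔ ∀ v x, H (shiftHomeo X v x) = shiftHomeo X v (H x) := by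
  refine ⟨fun h v x => ?_, fun h => Subgroup.mem_centralizer_iff.2 ?_⟩
  · exact (DFunLike.congr_fun (Subgroup.mem_centralizer_iff.1 h _ (mem_shiftGroup.2 ⟨v, rfl⟩))
      x).symm
  · intro g hg
    obtain ⟨v, rfl⟩ := mem_shiftGroup.1 hg
    exact Homeomorph.ext fun x => (h v x).symm

instance : AddCommGroup (Space ledrappier) := inferInstanceAs (AddCommGroup ledrappierSubmodule)

instance : Module (ZMod 2) (Space ledrappier) :=
  inferInstanceAs (Module (ZMod 2) ledrappierSubmodule)

theorem ledrappier_coe_add (x y : Space ledrappier) : (x + y).1 = x.1 + y.1 := rfl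

/-- Evaluation at a lattice point, as a linear functional. -/
def evalLinear (u : Fin 2 → ℤ) : Space ledrappier →ₗ[ZMod 2] ZMod 2 where
  toFun x := x.1 u
  map_add' _ _ := rfl
  map_smul' _ _ := rfl

theorem evalLinear_apply (u : Fin 2 → ℤ) (x : Space ledrappier) : evalLinear u x = x.1 u := rfl

theorem ledrappier_ext {x y : Space ledrappier} (h : ∀ u, x.1 u = y.1 u) : x = y :=
  Subtype.ext (funext h)

/-- A symmetry is additive. Its local rule has a finite window, so for large `q = 2 ^ k` there is a
point agreeing with `x` on the window and with `y` on the window translated by `(q, 0)`; by the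
dyadic triangle relation this point shows `x + y` on the window translated by `(0, q)`. -/
theorem map_add_of_mem_symmetryGroup {H : AutGroup ledrappier} (hH : H ∈ symmetryGroup ledrappier)
    (x y : Space ledrappier) : H (x + y) = H x + H y := by
  rw [mem_symmetryGroup] at hH
  obtain ⟨W, hW⟩ := exists_finset_forall_eq_of_continuous ledrappier
    (g := fun x => (H x).1 0) (by
      exact (continuous_apply (0 : Fin 2 → ℤ)).comp (continuous_subtype_val.comp H.continuous))
  obtain ⟨L, hL⟩ := exists_forall_abs_le W
  -- The row `-L` on `[-L, 3L]` determines the window.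
  have hrow : ∀ x y : Space ledrappier,
      (∀ m : ℤ, -L ≤ m → m ≤ 3 * L → x.1 ![m, -L] = y.1 ![m, -L]) →
      ∀ w ∈ W, x.1 w = y.1 w := by
    intro x y h w hw
    have h0 := abs_le.1 (hL w hw 0)
    have h1 := abs_le.1 (hL w hw 1)
    have := ledrappier_eq_of_row x.2 y.2 h (w 1 + L).toNat (w 0) (by omega) (by omega)
    rwa [show (-(L : ℤ) + ((w 1 + L).toNat : ℕ)) = w 1 by omega, ← eq_vec] at this
  have key : ∀ x y : Space ledrappier, (H (x + y)).1 0 = (H x).1 0 + (H y).1 0 := by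
    intro x y
    obtain ⟨k, hk⟩ : ∃ k : ℕ, 4 * (L : ℤ) < 2 ^ k := by
      refine ⟨4 * L, ?_⟩
      exact_mod_cast (Nat.lt_two_pow_self : 4 * L < 2 ^ (4 * L))
    obtain ⟨z, hz, hzr⟩ := exists_ledrappier_row
      (fun m => if m ≤ 3 * L then x.1 ![m, -L] else y.1 ![m - 2 ^ k, -L]) (-L)
    let z' : Space ledrappier := ⟨z, hz⟩
    have e1 : ∀ w ∈ W, z'.1 w = x.1 w :=
      hrow _ _ fun m _ hm => (hzr m).trans (if_pos hm)
    have e2 : ∀ w ∈ W, (shiftHomeo ledrappier ![2 ^ k, 0] z').1 w = y.1 w := by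
      refine hrow _ _ fun m hm _ => ?_
      rw [shiftHomeo_apply, vec_add, zero_add]
      refine (hzr _).trans ?_
      rw [if_neg (by omega), add_sub_cancel_left]
    have e3 : ∀ z : Space ledrappier, shiftHomeo ledrappier ![0, 2 ^ k] z
        = z + shiftHomeo ledrappier ![2 ^ k, 0] z := by
      refine fun z => ledrappier_ext fun u => ?_
      rw [ledrappier_coe_add, Pi.add_apply, shiftHomeo_apply, shiftHomeo_apply, eq_vec u, vec_add,
        vec_add, zero_add, zero_add, add_comm (2 ^ k), add_comm (2 ^ k)]
      exact ledrappier_up_two_pow z.2 k (u 0) (u 1)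
    have e4 : ∀ w ∈ W, (x + y).1 w = (shiftHomeo ledrappier ![0, 2 ^ k] z').1 w := by
      intro w hw
      rw [e3, ledrappier_coe_add, ledrappier_coe_add, Pi.add_apply, Pi.add_apply, e1 w hw, e2 w hw]
    calc (H (x + y)).1 0 = (H (shiftHomeo ledrappier ![0, 2 ^ k] z')).1 0 := hW _ _ e4
      _ = (H z').1 0 + (H (shiftHomeo ledrappier ![2 ^ k, 0] z')).1 0 := by
        rw [hH, e3, ledrappier_coe_add, Pi.add_apply, hH]
      _ = (H x).1 0 + (H y).1 0 := by
        have h1 : (H z').1 0 = (H x).1 0 := hW _ _ e1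
        have h2 : (H (shiftHomeo ledrappier ![2 ^ k, 0] z')).1 0 = (H y).1 0 := hW _ _ e2
        rw [h1, h2]
  refine ledrappier_ext fun u => ?_
  have hu : ∀ x : Space ledrappier, (H x).1 u = (H (shiftHomeo ledrappier u x)).1 0 := by
    intro x
    rw [hH, shiftHomeo_apply, add_zero]
  have hadd : shiftHomeo ledrappier u (x + y)
      = shiftHomeo ledrappier u x + shiftHomeo ledrappier u y := rfl
  rw [ledrappier_coe_add, Pi.add_apply, hu, hu x, hu y, hadd, key]

/-- A symmetry of Ledrappier's shift as a linear endomorphism. -/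
def symmetryLinear (H : AutGroup ledrappier) (hH : H ∈ symmetryGroup ledrappier) :
    Module.End (ZMod 2) (Space ledrappier) :=
  (AddMonoidHom.mk' H (map_add_of_mem_symmetryGroup hH)).toZModLinearMap 2

theorem symmetryLinear_apply {H : AutGroup ledrappier} (hH : H ∈ symmetryGroup ledrappier)
    (x : Space ledrappier) : symmetryLinear H hH x = H x := rfl

/-- The shift `S^v` as a linear endomorphism. -/
def shiftLinear (v : Fin 2 → ℤ) : Module.End (ZMod 2) (Space ledrappier) where
  toFun := shiftHomeo ledrappier v
  map_add' _ _ := rfl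
  map_smul' _ _ := rfl

theorem shiftLinear_apply (v : Fin 2 → ℤ) (x : Space ledrappier) :
    shiftLinear v x = shiftHomeo ledrappier v x := rfl

theorem shiftLinear_add (v w : Fin 2 → ℤ) :
    shiftLinear (v + w) = shiftLinear v * shiftLinear w := by
  refine LinearMap.ext fun x => ?_
  rw [Module.End.mul_apply, shiftLinear_apply, shiftHomeo_add]
  rfl

theorem shiftLinear_zero : shiftLinear 0 = 1 := by
  refine LinearMap.ext fun x => ?_
  rw [shiftLinear_apply, shiftHomeo_zero]
  rfl

theorem shiftLinear_nsmul (k : ℕ) (v : Fin 2 → ℤ) : shiftLinear (k • v) = shiftLinear v ^ k := by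
  induction k with
  | zero => rw [zero_smul, shiftLinear_zero, pow_zero]
  | succ k ih => rw [succ_nsmul, shiftLinear_add, ih, pow_succ]

/-! ### The polynomial calculus -/

theorem shiftLinear_vertical :
    shiftLinear ![0, 1] = aeval (shiftLinear ![1, 0]) (1 + X : (ZMod 2)[X]) := by
  rw [map_add, map_one, aeval_X]
  refine LinearMap.ext fun x => ledrappier_ext fun u => ?_
  rw [LinearMap.add_apply, Module.End.one_apply, ledrappier_coe_add, Pi.add_apply,
    shiftLinear_apply, shiftLinear_apply, shiftHomeo_apply, shiftHomeo_apply, eq_vec u, vec_add,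
    vec_add, zero_add, zero_add, add_comm 1, add_comm 1]
  exact ledrappier_up x.2 _ _

theorem shiftLinear_natCast (a b : ℕ) :
    shiftLinear ![a, b] = aeval (shiftLinear ![1, 0]) (X ^ a * (1 + X) ^ b : (ZMod 2)[X]) := by
  rw [map_mul, map_pow, map_pow, aeval_X, ← shiftLinear_vertical, ← shiftLinear_nsmul,
    ← shiftLinear_nsmul, ← shiftLinear_add]
  simp

/-- Row zero of a point is arbitrary, so distinct polynomials in the horizontal shift are distinct
endomorphisms. -/
theorem aeval_shiftLinear_injective :
    Function.Injective (aeval (R := ZMod 2) (shiftLinear ![1, 0])) := by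
  rw [injective_iff_map_eq_zero]
  intro p hp
  ext j
  obtain ⟨x, hx, hxr⟩ := exists_ledrappier_row_zero (fun m => if m = j then 1 else 0)
  have h := congrArg (evalLinear 0) (LinearMap.congr_fun hp ⟨x, hx⟩)
  rw [aeval_eq_sum_range, LinearMap.sum_apply, map_sum, LinearMap.zero_apply, map_zero] at h
  have hterm : ∀ i : ℕ, evalLinear 0 ((p.coeff i • shiftLinear ![1, 0] ^ i) ⟨x, hx⟩)
      = if i = j then p.coeff i else 0 := by
    intro i
    rw [LinearMap.smul_apply, map_smul, ← shiftLinear_nsmul, evalLinear_apply, shiftLinear_apply,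
      shiftHomeo_apply]
    have e : (i • ![1, 0] + 0 : Fin 2 → ℤ) = ![(i : ℤ), 0] := by simp
    rw [e]
    change p.coeff i • x ![(i : ℤ), 0] = _
    rw [hxr]
    simp
  simp only [hterm] at h
  rw [coeff_zero]
  by_cases hj : j ∈ Finset.range (p.natDegree + 1)
  · rwa [Finset.sum_ite_eq' _ j, if_pos hj] at h
  · exact coeff_eq_zero_of_natDegree_lt (by simpa [Nat.lt_succ_iff] using hj)

/-- Up to a shift, a symmetry is a polynomial in the horizontal shift. -/
theorem exists_shiftLinear_mul_symmetryLinear {H : AutGroup ledrappier}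
    (hH : H ∈ symmetryGroup ledrappier) :
    ∃ (K : ℕ) (P : (ZMod 2)[X]),
      shiftLinear ![K, K] * symmetryLinear H hH = aeval (shiftLinear ![1, 0]) P := by
  obtain ⟨W, hW⟩ := exists_finset_forall_eq_of_continuous ledrappier
    (g := fun x => (H x).1 0)
    ((continuous_apply (0 : Fin 2 → ℤ)).comp (continuous_subtype_val.comp H.continuous))
  obtain ⟨K, hK⟩ := exists_forall_abs_le W
  have hspan : (evalLinear 0).comp (symmetryLinear H hH) ∈
      Submodule.span (ZMod 2) (Set.range fun w : W => evalLinear w.1) := by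
    refine mem_span_of_iInf_ker_le_ker fun x hx => ?_
    rw [Submodule.mem_iInf] at hx
    have h := hW x 0 fun w hw => hx ⟨w, hw⟩
    have h0 : H 0 = 0 := map_zero (symmetryLinear H hH)
    rw [LinearMap.mem_ker, LinearMap.comp_apply, symmetryLinear_apply, evalLinear_apply]
    refine Eq.trans h ?_
    rw [h0]
    rfl
  obtain ⟨c, hc⟩ := (Submodule.mem_span_range_iff_exists_fun (ZMod 2)).1 hspan
  have hsum : shiftLinear ![K, K] * symmetryLinear H hH
      = ∑ w : W, c w • shiftLinear (![(K : ℤ), K] + w.1) := by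
    refine LinearMap.ext fun x => ledrappier_ext fun u => ?_
    have h := LinearMap.congr_fun hc (shiftHomeo ledrappier (![(K : ℤ), K] + u) x)
    rw [LinearMap.comp_apply, symmetryLinear_apply, mem_symmetryGroup.1 hH, evalLinear_apply,
      shiftHomeo_apply, add_zero, LinearMap.sum_apply] at h
    rw [Module.End.mul_apply, shiftLinear_apply, shiftHomeo_apply, symmetryLinear_apply, ← h,
      ← evalLinear_apply, LinearMap.sum_apply, map_sum]
    refine Finset.sum_congr rfl fun w _ => ?_
    rw [LinearMap.smul_apply, LinearMap.smul_apply, map_smul, evalLinear_apply, evalLinear_apply,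
      shiftLinear_apply, shiftHomeo_apply, shiftHomeo_apply, add_right_comm]
  have hmem : shiftLinear ![K, K] * symmetryLinear H hH ∈
      (aeval (R := ZMod 2) (shiftLinear ![1, 0])).range := by
    rw [hsum]
    refine Subalgebra.sum_mem _ fun w _ => Subalgebra.smul_mem _ ?_ _
    have h0 := abs_le.1 (hK w.1 w.2 0)
    have h1 := abs_le.1 (hK w.1 w.2 1)
    have e : (![(K : ℤ), K] + w.1 : Fin 2 → ℤ)
        = ![(((K + w.1 0).toNat : ℕ) : ℤ), (((K + w.1 1).toNat : ℕ) : ℤ)] := by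
      rw [Int.toNat_of_nonneg (by omega), Int.toNat_of_nonneg (by omega)]
      ext i
      fin_cases i <;> rfl
    rw [e, shiftLinear_natCast]
    exact ⟨_, rfl⟩
  obtain ⟨P, hP⟩ := hmem
  exact ⟨K, P, hP.symm⟩

theorem eq_of_associated_zmod_two {p q : (ZMod 2)[X]} (h : Associated p q) : p = q := by
  obtain ⟨u, rfl⟩ := h
  obtain ⟨c, hc, hu⟩ := Polynomial.isUnit_iff.1 u.isUnit
  have : c = 1 := by
    have h0 := hc.ne_zero
    clear hu hc
    revert c; decide
  rw [← hu, this, C_1, mul_one]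

theorem eq_of_dvd_X_pow_mul {P : (ZMod 2)[X]} {a b : ℕ} (h : P ∣ X ^ a * (1 + X) ^ b) :
    ∃ i j : ℕ, P = X ^ i * (1 + X) ^ j := by
  obtain ⟨A, B, hA, hB, rfl⟩ := exists_dvd_and_dvd_of_dvd_mul h
  have hp : Prime (1 + X : (ZMod 2)[X]) := by
    rw [add_comm, ← C_1, ← sub_neg_eq_add, ← C_neg]
    exact prime_X_sub_C _
  obtain ⟨i, -, hi⟩ := (dvd_prime_pow prime_X a).1 hA
  obtain ⟨j, -, hj⟩ := (dvd_prime_pow hp b).1 hB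
  exact ⟨i, j, by rw [eq_of_associated_zmod_two hi, eq_of_associated_zmod_two hj]⟩

theorem symmetryGroup_ledrappier : symmetryGroup ledrappier = shiftGroup ledrappier := by
  refine le_antisymm (fun H hH => ?_) fun H hH => ?_
  · have hH' := (symmetryGroup ledrappier).inv_mem hH
    obtain ⟨K, P, hP⟩ := exists_shiftLinear_mul_symmetryLinear hH
    obtain ⟨L, Q, hQ⟩ := exists_shiftLinear_mul_symmetryLinear hH'
    have hPQ : P * Q = X ^ (K + L) * (1 + X) ^ (K + L) := by
      refine aeval_shiftLinear_injective ?_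
      rw [map_mul, ← hP, ← hQ, ← shiftLinear_natCast]
      refine LinearMap.ext fun x => ?_
      simp only [Module.End.mul_apply, symmetryLinear_apply, shiftLinear_apply]
      rw [mem_symmetryGroup.1 hH, show H (H⁻¹ x) = x from H.apply_symm_apply x,
        ← Homeomorph.mul_apply, ← shiftHomeo_add, vec_add]
      push_cast
      rfl
    obtain ⟨i, j, rfl⟩ := eq_of_dvd_X_pow_mul (Dvd.intro Q hPQ)
    rw [← shiftLinear_natCast] at hP
    have h : shiftHomeo ledrappier ![K, K] * H = shiftHomeo ledrappier ![i, j] :=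
      Homeomorph.ext fun x => LinearMap.congr_fun hP x
    exact mem_shiftGroup.2 ⟨-![(K : ℤ), K] + ![(i : ℤ), j], by
      rw [shiftHomeo_add, shiftHomeo_neg, ← h, inv_mul_cancel_left]⟩
  · obtain ⟨v, rfl⟩ := mem_shiftGroup.1 hH
    refine mem_symmetryGroup.2 fun w x => ?_
    rw [← Homeomorph.mul_apply, ← Homeomorph.mul_apply, ← shiftHomeo_add, ← shiftHomeo_add,
      add_comm]

/-! ### The triangle group -/

theorem mulVec_vec (M : Matrix (Fin 2) (Fin 2) ℤ) (m n : ℤ) :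
    M *ᵥ ![m, n] = ![M 0 0 * m + M 0 1 * n, M 1 0 * m + M 1 1 * n] := by
  ext i
  fin_cases i <;> simp [mulVec, dotProduct, Fin.sum_univ_two]

theorem mem_triangle_iff {m n a b : ℤ} :
    (![a, b] : Fin 2 → ℤ) ∈ ({![m, n], ![m + 1, n], ![m, n + 1]} : Set (Fin 2 → ℤ)) ↔
      (a = m ∧ b = n) ∨ (a = m + 1 ∧ b = n) ∨ (a = m ∧ b = n + 1) := by
  simp [funext_iff, Fin.forall_fin_two]

/-- The six matrices mapping elementary triangles to elementary triangles. Equivalently, the two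
rows are distinct members of `{(1, 0), (0, 1), (-1, -1)}`, the inner edge normals of the elementary
triangles. -/
def IsTriangleMatrix (M : Matrix (Fin 2) (Fin 2) ℤ) : Prop :=
  M ∈ ({!![1, 0; 0, 1], !![0, 1; 1, 0], !![-1, -1; 0, 1],
    !![0, 1; -1, -1], !![1, 0; -1, -1], !![-1, -1; 1, 0]} : Set (Matrix (Fin 2) (Fin 2) ℤ))

theorem isTriangleMatrix_iff {M : Matrix (Fin 2) (Fin 2) ℤ} : IsTriangleMatrix M ↔
    (M 0 0 = 1 ∧ M 0 1 = 0 ∧ M 1 0 = 0 ∧ M 1 1 = 1) ∨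
    (M 0 0 = 0 ∧ M 0 1 = 1 ∧ M 1 0 = 1 ∧ M 1 1 = 0) ∨
    (M 0 0 = -1 ∧ M 0 1 = -1 ∧ M 1 0 = 0 ∧ M 1 1 = 1) ∨
    (M 0 0 = 0 ∧ M 0 1 = 1 ∧ M 1 0 = -1 ∧ M 1 1 = -1) ∨
    (M 0 0 = 1 ∧ M 0 1 = 0 ∧ M 1 0 = -1 ∧ M 1 1 = -1) ∨
    (M 0 0 = -1 ∧ M 0 1 = -1 ∧ M 1 0 = 1 ∧ M 1 1 = 0) := by
  simp only [IsTriangleMatrix, Set.mem_insert_iff, Set.mem_singleton_iff, ← Matrix.ext_iff,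
    Fin.forall_fin_two]
  simp [and_assoc]

theorem mul_inv_entries (M : GL (Fin 2) ℤ) :
    M.val 0 0 * (M⁻¹).val 0 0 + M.val 0 1 * (M⁻¹).val 1 0 = 1 ∧
    M.val 0 0 * (M⁻¹).val 0 1 + M.val 0 1 * (M⁻¹).val 1 1 = 0 ∧
    M.val 1 0 * (M⁻¹).val 0 0 + M.val 1 1 * (M⁻¹).val 1 0 = 0 ∧
    M.val 1 0 * (M⁻¹).val 0 1 + M.val 1 1 * (M⁻¹).val 1 1 = 1 := by
  have h : M.val * (M⁻¹).val = 1 := by rw [← Units.val_mul, mul_inv_cancel, Units.val_one]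
  refine ⟨?_, ?_, ?_, ?_⟩
  · simpa [mul_apply, Fin.sum_univ_two] using congrFun (congrFun h 0) 0
  · simpa [mul_apply, Fin.sum_univ_two] using congrFun (congrFun h 0) 1
  · simpa [mul_apply, Fin.sum_univ_two] using congrFun (congrFun h 1) 0
  · simpa [mul_apply, Fin.sum_univ_two] using congrFun (congrFun h 1) 1

theorem IsTriangleMatrix.inv {M : GL (Fin 2) ℤ} (h : IsTriangleMatrix M.val) :
    IsTriangleMatrix (M⁻¹).val := by
  obtain ⟨h1, h2, h3, h4⟩ := mul_inv_entries M
  rw [isTriangleMatrix_iff] at h ⊢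
  rcases h with h | h | h | h | h | h <;> obtain ⟨a, b, c, d⟩ := h <;>
    rw [a, b] at h1 h2 <;> rw [c, d] at h3 h4 <;> omega

theorem IsTriangleMatrix.image_mem {M : Matrix (Fin 2) (Fin 2) ℤ} (h : IsTriangleMatrix M)
    {T : Set (Fin 2 → ℤ)} (hT : T ∈ elementaryTriangles) :
    (fun v => M *ᵥ v) '' T ∈ elementaryTriangles := by
  obtain ⟨m, n, rfl⟩ := hT
  rw [isTriangleMatrix_iff] at h
  simp only [Set.image_insert_eq, Set.image_singleton, mulVec_vec]
  have key : ∀ m' n' : ℤ, ∀ p q r : Fin 2 → ℤ,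
      ({p, q, r} : Set (Fin 2 → ℤ)) = {![m', n'], ![m' + 1, n'], ![m', n' + 1]} →
      ({p, q, r} : Set (Fin 2 → ℤ)) ∈ elementaryTriangles := fun m' n' p q r h => ⟨m', n', h⟩
  rcases h with h | h | h | h | h | h <;> obtain ⟨a, b, c, d⟩ := h <;> rw [a, b, c, d]
  · refine key m n _ _ _ ?_
    ext u
    rw [eq_vec u, mem_triangle_iff]
    simp only [Set.mem_insert_iff, Set.mem_singleton_iff, vecCons_inj, and_true]
    omega
  · refine key n m _ _ _ ?_
    ext u
    rw [eq_vec u, mem_triangle_iff]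
    simp only [Set.mem_insert_iff, Set.mem_singleton_iff, vecCons_inj, and_true]
    omega
  · refine key (-m - n - 1) n _ _ _ ?_
    ext u
    rw [eq_vec u, mem_triangle_iff]
    simp only [Set.mem_insert_iff, Set.mem_singleton_iff, vecCons_inj, and_true]
    omega
  · refine key n (-m - n - 1) _ _ _ ?_
    ext u
    rw [eq_vec u, mem_triangle_iff]
    simp only [Set.mem_insert_iff, Set.mem_singleton_iff, vecCons_inj, and_true]
    omega
  · refine key m (-m - n - 1) _ _ _ ?_
    ext u
    rw [eq_vec u, mem_triangle_iff]
    simp only [Set.mem_insert_iff, Set.mem_singleton_iff, vecCons_inj, and_true]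
    omega
  · refine key (-m - n - 1) m _ _ _ ?_
    ext u
    rw [eq_vec u, mem_triangle_iff]
    simp only [Set.mem_insert_iff, Set.mem_singleton_iff, vecCons_inj, and_true]
    omega

theorem mem_D3_iff {M : GL (Fin 2) ℤ} : M ∈ D3 ↔ IsTriangleMatrix M.val := by
  constructor
  · intro h
    obtain ⟨m, n, hT⟩ := (h {![0, 0], ![0 + 1, 0], ![0, 0 + 1]}).1 ⟨0, 0, rfl⟩
    have hinj : Function.Injective (fun v : Fin 2 → ℤ => M.val *ᵥ v) := by
      intro v w hvw
      have := congrArg (fun v => (M⁻¹).val *ᵥ v) hvw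
      simpa only [Matrix.mulVec_mulVec, ← Units.val_mul, inv_mul_cancel, Units.val_one,
        Matrix.one_mulVec] using this
    simp only [Set.image_insert_eq, Set.image_singleton, mulVec_vec] at hT
    have h0 : (![0, 0] : Fin 2 → ℤ) ∈
        ({![m, n], ![m + 1, n], ![m, n + 1]} : Set (Fin 2 → ℤ)) := by
      rw [← hT]; simp
    have h1 : (![M.val 0 0, M.val 1 0] : Fin 2 → ℤ) ∈
        ({![m, n], ![m + 1, n], ![m, n + 1]} : Set (Fin 2 → ℤ)) := by
      rw [← hT]; simp
    have h2 : (![M.val 0 1, M.val 1 1] : Fin 2 → ℤ) ∈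
        ({![m, n], ![m + 1, n], ![m, n + 1]} : Set (Fin 2 → ℤ)) := by
      rw [← hT]; simp
    rw [mem_triangle_iff] at h0 h1 h2
    rw [isTriangleMatrix_iff]
    have n1 : ¬ (M.val 0 0 = 0 ∧ M.val 1 0 = 0) := by
      rintro ⟨a, b⟩
      have := hinj (a₁ := ![1, 0]) (a₂ := 0) (by simp only [mulVec_vec, a, b]; simp)
      simpa using congrFun this 0
    have n2 : ¬ (M.val 0 1 = 0 ∧ M.val 1 1 = 0) := by
      rintro ⟨a, b⟩
      have := hinj (a₁ := ![0, 1]) (a₂ := 0) (by simp only [mulVec_vec, a, b]; simp)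
      simpa using congrFun this 1
    have n3 : ¬ (M.val 0 0 = M.val 0 1 ∧ M.val 1 0 = M.val 1 1) := by
      rintro ⟨a, b⟩
      have := hinj (a₁ := ![1, 0]) (a₂ := ![0, 1]) (by simp only [mulVec_vec, a, b]; simp)
      simpa using congrFun this 0
    clear hT hinj h
    generalize M.val 0 0 = a, M.val 0 1 = b, M.val 1 0 = c, M.val 1 1 = d at *
    -- The vertex `0` of the triangle is one of the three vertices of its image.
    have hmn : (m = 0 ∧ n = 0) ∨ (m = -1 ∧ n = 0) ∨ (m = 0 ∧ n = -1) := by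
      clear n1 n2 n3 h1 h2
      omega
    clear h0
    rcases hmn with ⟨rfl, rfl⟩ | ⟨rfl, rfl⟩ | ⟨rfl, rfl⟩ <;>
      rcases h1 with ⟨rfl, rfl⟩ | ⟨rfl, rfl⟩ | ⟨rfl, rfl⟩ <;>
      rcases h2 with ⟨rfl, rfl⟩ | ⟨rfl, rfl⟩ | ⟨rfl, rfl⟩ <;>
      revert n1 n2 n3 <;> decide
  · intro h T
    refine ⟨h.image_mem, fun hT => ?_⟩
    have := h.inv.image_mem hT
    rw [Set.image_image] at this
    simpa only [Matrix.mulVec_mulVec, ← Units.val_mul, inv_mul_cancel, Units.val_one,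
      Matrix.one_mulVec, Set.image_id'] using this

/-- The two-dimensional integral representation of the dihedral group with six elements, generated
by a rotation `r 1` of the elementary triangles and the transposition `sr 0` of coordinates. -/
def dihedralMatrix : DihedralGroup 3 →* Matrix (Fin 2) (Fin 2) ℤ where
  toFun
    | .r i => !![0, 1; -1, -1] ^ i.val
    | .sr i => !![0, 1; 1, 0] * !![0, 1; -1, -1] ^ i.val
  map_one' := by decide
  map_mul' := by decide

theorem dihedralMatrix_injective : Function.Injective dihedralMatrix := by decide

theorem exists_dihedralMatrix_eq_iff {M : Matrix (Fin 2) (Fin 2) ℤ} :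
    (∃ g, dihedralMatrix g = M) ↔ IsTriangleMatrix M := by
  constructor
  · rintro ⟨g, rfl⟩
    rw [isTriangleMatrix_iff]
    revert g
    decide
  · rintro (rfl | rfl | rfl | rfl | rfl | rfl)
    · exact ⟨.r 0, by decide⟩
    · exact ⟨.sr 0, by decide⟩
    · exact ⟨.sr 1, by decide⟩
    · exact ⟨.r 1, by decide⟩
    · exact ⟨.sr 2, by decide⟩
    · exact ⟨.r 2, by decide⟩

theorem nonempty_D3_mulEquiv : Nonempty (D3 ≃* DihedralGroup 3) := by
  have hinj : Function.Injective dihedralMatrix.toHomUnits := fun g h hgh =>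
    dihedralMatrix_injective (congrArg Units.val hgh)
  have hrange : dihedralMatrix.toHomUnits.range = D3 := by
    ext M
    rw [mem_D3_iff, ← exists_dihedralMatrix_eq_iff, MonoidHom.mem_range]
    exact exists_congr fun g => ⟨fun h => congrArg Units.val h, fun h => Units.ext h⟩
  exact ⟨((MonoidHom.ofInjective hinj).trans (MulEquiv.subgroupCongr hrange)).symm⟩

theorem card_D3 : Nat.card D3 = 6 := by
  obtain ⟨e⟩ := nonempty_D3_mulEquiv
  rw [Nat.card_congr e.toEquiv, DihedralGroup.nat_card]

/-- The rotations and a reflection split the triangle group as `C₃ ⋊ C₂`. -/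
theorem exists_D3_complement : ∃ C₃ C₂ : Subgroup D3, C₃.Normal ∧ IsCyclic C₃ ∧ Nat.card C₃ = 3 ∧
    IsCyclic C₂ ∧ Nat.card C₂ = 2 ∧ Subgroup.IsComplement' C₃ C₂ := by
  obtain ⟨e⟩ := nonempty_D3_mulEquiv
  have : Finite D3 := Finite.of_equiv _ e.symm.toEquiv
  have h3 : Nat.card (Subgroup.zpowers (e.symm (.r 1))) = 3 := by
    rw [Nat.card_zpowers, MulEquiv.orderOf_eq, DihedralGroup.orderOf_r_one]
  have h2 : Nat.card (Subgroup.zpowers (e.symm (.sr 0))) = 2 := by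
    rw [Nat.card_zpowers, MulEquiv.orderOf_eq, DihedralGroup.orderOf_sr]
  refine ⟨_, _, ?_, inferInstance, h3, inferInstance, h2, ?_⟩
  · refine Subgroup.normal_of_index_eq_two ?_
    have := Subgroup.card_mul_index (Subgroup.zpowers (e.symm (.r 1)))
    rw [h3, card_D3] at this
    omega
  · refine Subgroup.isComplement'_of_coprime ?_ ?_
    · rw [h2, h3, card_D3]
    · rw [h2, h3]; decide

/-! ### Extended symmetries and their matrices -/

theorem ConjugatesShiftsBy.map_shiftHomeo {d : ℕ} {A : Type*} [TopologicalSpace A]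
    {X : Subshift A (Fin d → ℤ)} {H : AutGroup X} {M : GL (Fin d) ℤ}
    (h : ConjugatesShiftsBy X H M) (v : Fin d → ℤ) (x : Space X) :
    H (shiftHomeo X v x) = shiftHomeo X (M.val *ᵥ v) (H x) :=
  DFunLike.congr_fun (mul_inv_eq_iff_eq_mul.1 (h v)) x

theorem ConjugatesShiftsBy.mem_extendedSymmetryGroup {d : ℕ} {A : Type*} [TopologicalSpace A]
    {X : Subshift A (Fin d → ℤ)} {H : AutGroup X} {M : GL (Fin d) ℤ}
    (h : ConjugatesShiftsBy X H M) : H ∈ extendedSymmetryGroup X := by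
  refine Subgroup.mem_normalizer_iff.2 fun g => ⟨fun hg => ?_, fun hg => ?_⟩
  · obtain ⟨v, rfl⟩ := mem_shiftGroup.1 hg
    exact mem_shiftGroup.2 ⟨_, h v⟩
  · obtain ⟨w, hw⟩ := mem_shiftGroup.1 hg
    refine mem_shiftGroup.2 ⟨(M⁻¹).val *ᵥ w, ?_⟩
    have h' := h ((M⁻¹).val *ᵥ w)
    rw [Matrix.mulVec_mulVec, ← Units.val_mul, mul_inv_cancel, Units.val_one, Matrix.one_mulVec,
      ← hw] at h'
    exact (mul_left_cancel (mul_right_cancel h')).symm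

theorem exists_linearMap_conj {d : ℕ} {A : Type*} [TopologicalSpace A]
    {X : Subshift A (Fin d → ℤ)} (hX : Function.Injective (shiftHomeo X)) {H : AutGroup X}
    (hH : H ∈ extendedSymmetryGroup X) :
    ∃ F : (Fin d → ℤ) →ₗ[ℤ] (Fin d → ℤ), ∀ v, H * shiftHomeo X v * H⁻¹ = shiftHomeo X (F v) := by
  have h : ∀ v, ∃ w, H * shiftHomeo X v * H⁻¹ = shiftHomeo X w := fun v =>
    mem_shiftGroup.1 ((Subgroup.mem_normalizer_iff.1 hH _).1 (mem_shiftGroup.2 ⟨v, rfl⟩))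
  choose f hf using h
  refine ⟨(AddMonoidHom.mk' f fun v w => hX ?_).toIntLinearMap, hf⟩
  rw [← hf, shiftHomeo_add, shiftHomeo_add, ← hf, ← hf]
  group

/-- If the shift action is faithful, conjugation by an extended symmetry is an automorphism of
`ℤ^d` and hence given by a matrix. -/
theorem exists_conjugatesShiftsBy {d : ℕ} {A : Type*} [TopologicalSpace A]
    {X : Subshift A (Fin d → ℤ)} (hX : Function.Injective (shiftHomeo X)) {H : AutGroup X}
    (hH : H ∈ extendedSymmetryGroup X) : ∃ M : GL (Fin d) ℤ, ConjugatesShiftsBy X H M := by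
  obtain ⟨F, hF⟩ := exists_linearMap_conj hX hH
  obtain ⟨G, hG⟩ := exists_linearMap_conj hX ((extendedSymmetryGroup X).inv_mem hH)
  have hFG : F ∘ₗ G = LinearMap.id := LinearMap.ext fun v => hX <| by
    rw [LinearMap.comp_apply, ← hF, ← hG, LinearMap.id_apply]
    group
  have hGF : G ∘ₗ F = LinearMap.id := LinearMap.ext fun v => hX <| by
    rw [LinearMap.comp_apply, ← hG, ← hF, LinearMap.id_apply]
    group
  refine ⟨⟨LinearMap.toMatrix' F, LinearMap.toMatrix' G, ?_, ?_⟩, fun v => ?_⟩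
  · rw [← LinearMap.toMatrix'_comp, hFG, LinearMap.toMatrix'_id]
  · rw [← LinearMap.toMatrix'_comp, hGF, LinearMap.toMatrix'_id]
  · rw [hF, LinearMap.toMatrix'_mulVec]

/-! ### Half-planes determining a point -/

/-- If a nonzero point of Ledrappier's shift vanishes on a half-plane `L ≤ p * u 0 + q * u 1`,
then `(p, q)` is a nonnegative multiple of one of the inner edge normals `(0, 1)`, `(1, 0)`,
`(-1, -1)` of the elementary triangles: otherwise the functional attains its minimum over each
elementary triangle at a single vertex, so the zeros propagate to the whole lattice. -/
theorem edgeNormal_of_zero_halfPlane {y : Config 2 (ZMod 2)} (hy : y ∈ ledrappier.carrier)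
    (hne : ∃ u, y u ≠ 0) {p q L : ℤ}
    (h0 : ∀ m n : ℤ, L ≤ p * m + q * n → y ![m, n] = 0) :
    (p = 0 ∧ 0 ≤ q) ∨ (q = 0 ∧ 0 ≤ p) ∨ (p = q ∧ p ≤ 0) := by
  by_contra hpq
  have hk : ∀ k : ℕ, ∀ m n : ℤ, L - k ≤ p * m + q * n → y ![m, n] = 0 := by
    intro k
    induction k with
    | zero => simpa using h0
    | succ k ih =>
      intro m n hmn
      push_cast at hmn
      have hcase : (0 < p ∧ 0 < q) ∨ (p < 0 ∧ p < q) ∨ (q < 0 ∧ q < p) := by omega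
      rcases hcase with ⟨hp, hq⟩ | ⟨hp, hq⟩ | ⟨hp, hq⟩
      · have h := hy m n
        rwa [ih (m + 1) n (by linarith), ih m (n + 1) (by linarith), add_zero, add_zero] at h
      · have h := hy (m - 1) n
        rwa [sub_add_cancel, ih (m - 1) n (by linarith), ih (m - 1) (n + 1) (by linarith),
          add_zero, zero_add] at h
      · have h := hy m (n - 1)
        rwa [sub_add_cancel, ih m (n - 1) (by linarith), ih (m + 1) (n - 1) (by linarith),
          add_zero, zero_add] at h
  obtain ⟨u, hu⟩ := hne
  refine hu ?_
  rw [eq_vec u]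
  exact hk (L - (p * u 0 + q * u 1)).toNat _ _ (by omega)

theorem isTriangleMatrix_of_edgeNormal {N : Matrix (Fin 2) (Fin 2) ℤ} (hdet : IsUnit N.det)
    (h : ∀ i, (N i 0 = 0 ∧ 0 ≤ N i 1) ∨ (N i 1 = 0 ∧ 0 ≤ N i 0) ∨
      (N i 0 = N i 1 ∧ N i 0 ≤ 0)) : IsTriangleMatrix N := by
  have hrow : ∀ i, ∃ k a b : ℤ, 0 ≤ k ∧ N i 0 = k * a ∧ N i 1 = k * b ∧
      ((a = 0 ∧ b = 1) ∨ (a = 1 ∧ b = 0) ∨ (a = -1 ∧ b = -1)) := by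
    intro i
    rcases h i with ⟨h1, h2⟩ | ⟨h1, h2⟩ | ⟨h1, h2⟩
    · exact ⟨N i 1, 0, 1, h2, by omega, by omega, by simp⟩
    · exact ⟨N i 0, 1, 0, h2, by omega, by omega, by simp⟩
    · exact ⟨-N i 0, -1, -1, by omega, by omega, by omega, by simp⟩
  obtain ⟨k, a, b, hk, ha, hb, hab⟩ := hrow 0
  obtain ⟨l, c, d, hl, hc, hd, hcd⟩ := hrow 1
  rw [det_fin_two, ha, hb, hc, hd,
    show k * a * (l * d) - k * b * (l * c) = k * l * (a * d - b * c) by ring,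
    IsUnit.mul_iff, IsUnit.mul_iff, Int.isUnit_iff, Int.isUnit_iff] at hdet
  obtain ⟨⟨hk1, hl1⟩, hu⟩ := hdet
  obtain rfl : k = 1 := by omega
  obtain rfl : l = 1 := by omega
  rw [isTriangleMatrix_iff, ha, hb, hc, hd]
  clear ha hb hc hd hk hl hk1 hl1
  rcases hab with ⟨rfl, rfl⟩ | ⟨rfl, rfl⟩ | ⟨rfl, rfl⟩ <;>
    rcases hcd with ⟨rfl, rfl⟩ | ⟨rfl, rfl⟩ | ⟨rfl, rfl⟩ <;>
    simp at hu ⊢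

/-- The matrix of an extended symmetry `H` belongs to the triangle group. A nonzero point `x`
vanishing on the half-plane `0 ≤ u i` is sent by `H` to a point which agrees with `H 0` on a
half-plane whose normal is the `i`-th row of `M⁻¹`, so that both rows of `M⁻¹` are multiples
of edge normals. -/
theorem ConjugatesShiftsBy.mem_D3 {H : AutGroup ledrappier} {M : GL (Fin 2) ℤ}
    (h : ConjugatesShiftsBy ledrappier H M) : M ∈ D3 := by
  rw [← inv_mem_iff, mem_D3_iff]
  refine isTriangleMatrix_of_edgeNormal
    ((Matrix.isUnit_iff_isUnit_det _).1 (M⁻¹).isUnit) fun i => ?_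
  obtain ⟨x, hx, hx0, hx1⟩ := exists_ledrappier_zero_halfPlane i
  let x' : Space ledrappier := ⟨x, hx⟩
  obtain ⟨W, hW⟩ := exists_finset_forall_eq_of_continuous ledrappier
    (g := fun x => (H x).1 0)
    ((continuous_apply (0 : Fin 2 → ℤ)).comp (continuous_subtype_val.comp H.continuous))
  obtain ⟨L, hL⟩ := exists_forall_abs_le W
  have hloc : ∀ (z : Space ledrappier) u,
      (H z).1 u = (H (shiftHomeo ledrappier ((M⁻¹).val *ᵥ u) z)).1 0 := by
    intro z u
    rw [h.map_shiftHomeo, Matrix.mulVec_mulVec, ← Units.val_mul, mul_inv_cancel, Units.val_one,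
      Matrix.one_mulVec, shiftHomeo_apply, add_zero]
  have hxne : x' ≠ 0 := by
    intro hx'
    have : x (fun _ => -1) = 0 := congrArg (fun z : Space ledrappier => z.1 fun _ => -1) hx'
    rw [hx1 _ rfl] at this
    exact one_ne_zero this
  refine edgeNormal_of_zero_halfPlane (H x' - H 0).2 (L := L) ?_ fun m n hmn => ?_
  · by_contra! hall
    exact hxne (H.injective (sub_eq_zero.1 (ledrappier_ext hall)))
  · change (H x').1 ![m, n] - (H 0).1 ![m, n] = 0
    rw [hloc x', hloc 0, sub_eq_zero]
    refine hW (shiftHomeo ledrappier _ x') (shiftHomeo ledrappier _ 0) fun w hw => ?_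
    rw [shiftHomeo_apply, shiftHomeo_apply]
    refine hx0 _ ?_
    have hw := abs_le.1 (hL w hw i)
    rw [Pi.add_apply]
    simp only [mulVec, dotProduct, Fin.sum_univ_two, cons_val_zero, cons_val_one]
    linarith

/-! ### The semidirect product -/

theorem continuous_coordMap {d : ℕ} {A : Type*} [TopologicalSpace A] (M : GL (Fin d) ℤ) :
    Continuous (coordMap M : Config d A → Config d A) :=
  continuous_pi fun _ => continuous_apply _

theorem coordMap_one {d : ℕ} {A : Type*} (x : Config d A) : coordMap 1 x = x := by
  funext u
  simp [coordMap]

theorem coordMap_mul {d : ℕ} {A : Type*} (M N : GL (Fin d) ℤ) (x : Config d A) :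
    coordMap (M * N) x = coordMap M (coordMap N x) := by
  funext u
  simp only [coordMap, _root_.mul_inv_rev, Units.val_mul, Matrix.mulVec_mulVec]

theorem coordMap_mem_ledrappier {M : GL (Fin 2) ℤ} (hM : M ∈ D3) {x : Config 2 (ZMod 2)}
    (hx : x ∈ ledrappier.carrier) : coordMap M x ∈ ledrappier.carrier := by
  intro m n
  have h := isTriangleMatrix_iff.1 (mem_D3_iff.1 hM).inv
  simp only [coordMap, mulVec_vec]
  rcases h with h | h | h | h | h | h <;> obtain ⟨a, b, c, d⟩ := h <;> rw [a, b, c, d]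
  · rw [← hx m n]; ring_nf
  · rw [← hx n m]; ring_nf
  · rw [← hx (-m - n - 1) n]; ring_nf
  · rw [← hx n (-m - n - 1)]; ring_nf
  · rw [← hx m (-m - n - 1)]; ring_nf
  · rw [← hx (-m - n - 1) m]; ring_nf

/-- The coordinate transformations `h_M` of Ledrappier's shift, for `M` in the triangle group. -/
def coordHom : D3 →* AutGroup ledrappier where
  toFun M :=
    { toFun := fun x => ⟨coordMap M.1 x.1, coordMap_mem_ledrappier M.2 x.2⟩
      invFun := fun x => ⟨coordMap M.1⁻¹ x.1, coordMap_mem_ledrappier (D3.inv_mem M.2) x.2⟩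
      left_inv := fun x => Subtype.ext (by
        simp only [← coordMap_mul, inv_mul_cancel, coordMap_one])
      right_inv := fun x => Subtype.ext (by
        simp only [← coordMap_mul, mul_inv_cancel, coordMap_one])
      continuous_toFun :=
        ((continuous_coordMap M.1).comp continuous_subtype_val).subtype_mk _
      continuous_invFun :=
        ((continuous_coordMap M.1⁻¹).comp continuous_subtype_val).subtype_mk _ }
  map_one' := Homeomorph.ext fun x => Subtype.ext (coordMap_one x.1)
  map_mul' M N := Homeomorph.ext fun x => Subtype.ext (coordMap_mul M.1 N.1 x.1)

theorem coordHom_apply_coe (M : D3) (x : Space ledrappier) :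
    (coordHom M x).1 = coordMap M.1 x.1 := rfl

theorem conjugatesShiftsBy_coordHom (M : D3) :
    ConjugatesShiftsBy ledrappier (coordHom M) M.1 := by
  intro v
  rw [mul_inv_eq_iff_eq_mul]
  refine Homeomorph.ext fun x => ledrappier_ext fun u => ?_
  rw [Homeomorph.mul_apply, Homeomorph.mul_apply, shiftHomeo_apply, coordHom_apply_coe,
    coordHom_apply_coe, coordMap, coordMap, shiftHomeo_apply, mulVec_add, Matrix.mulVec_mulVec,
    ← Units.val_mul, inv_mul_cancel, Units.val_one, Matrix.one_mulVec]

/-- The homomorphism `(v, M) ↦ S^v h_M`. -/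
def semidirectHom : Multiplicative (Fin 2 → ℤ) ⋊[(linearAction 2).comp D3.subtype] D3 →*
    AutGroup ledrappier :=
  SemidirectProduct.lift (shiftHom ledrappier) coordHom fun M => MonoidHom.ext fun v =>
    (conjugatesShiftsBy_coordHom M v.toAdd).symm

theorem semidirectHom_apply (v : Fin 2 → ℤ) (M : D3) :
    semidirectHom ⟨.ofAdd v, M⟩ = shiftHomeo ledrappier v * coordHom M := rfl

theorem conjugatesShiftsBy_semidirectHom (v : Fin 2 → ℤ) (M : D3) :
    ConjugatesShiftsBy ledrappier (semidirectHom ⟨.ofAdd v, M⟩) M.1 := by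
  intro w
  rw [semidirectHom_apply, _root_.mul_inv_rev, ← mul_assoc, mul_assoc _ (coordHom M),
    mul_assoc _ (_ * _), conjugatesShiftsBy_coordHom, ← shiftHomeo_add, add_comm, shiftHomeo_add,
    mul_inv_cancel_right]

theorem semidirectHom_injective : Function.Injective semidirectHom := by
  rw [injective_iff_map_eq_one]
  rintro ⟨v, M⟩ h
  have hM : M = 1 := by
    refine Subtype.ext (Units.ext (Matrix.ext_of_mulVec_single fun i => ?_))
    have hc := conjugatesShiftsBy_semidirectHom v.toAdd M (Pi.single i 1)
    change semidirectHom ⟨v, M⟩ * _ * (semidirectHom ⟨v, M⟩)⁻¹ = _ at hc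
    rw [h, inv_one, mul_one, one_mul] at hc
    rw [← shiftHomeo_ledrappier_injective hc]
    exact (Matrix.one_mulVec _).symm
  subst hM
  have hv : shiftHom ledrappier v = 1 := by
    have : semidirectHom ⟨v, 1⟩ = shiftHom ledrappier v * coordHom 1 := rfl
    rwa [h, map_one, mul_one, eq_comm] at this
  rw [(injective_iff_map_eq_one _).1 shiftHom_ledrappier_injective v hv]
  rfl

theorem range_semidirectHom : semidirectHom.range = extendedSymmetryGroup ledrappier := by
  ext H
  constructor
  · rintro ⟨⟨v, M⟩, rfl⟩
    exact (conjugatesShiftsBy_semidirectHom v.toAdd M).mem_extendedSymmetryGroup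
  · intro hH
    obtain ⟨M, hM⟩ := exists_conjugatesShiftsBy shiftHomeo_ledrappier_injective hH
    let M' : D3 := ⟨M, hM.mem_D3⟩
    -- Dividing by `h_M` leaves a symmetry, that is, a shift.
    have hsymm : H * (coordHom M')⁻¹ ∈ symmetryGroup ledrappier := by
      refine Subgroup.mem_centralizer_iff.2 fun g hg => ?_
      obtain ⟨v, rfl⟩ := mem_shiftGroup.1 hg
      have h1 := hM ((M⁻¹).val *ᵥ v)
      have h2 := conjugatesShiftsBy_coordHom M' ((M⁻¹).val *ᵥ v)
      rw [Matrix.mulVec_mulVec, ← Units.val_mul, mul_inv_cancel, Units.val_one,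
        Matrix.one_mulVec] at h1 h2
      nth_rw 1 [← h1]
      rw [← h2]
      group
    rw [symmetryGroup_ledrappier] at hsymm
    obtain ⟨v, hv⟩ := mem_shiftGroup.1 hsymm
    refine ⟨⟨.ofAdd v, M'⟩, ?_⟩
    rw [semidirectHom_apply, ← hv, inv_mul_cancel_right]

end ZdShift

theorem mainTheorem2 :
    -- the shift action is faithful, and every symmetry is a shift: `𝒮 (X) = ℤ²`
    Function.Injective (ZdShift.shiftHom ZdShift.ledrappier) ∧
    ZdShift.symmetryGroup ZdShift.ledrappier = ZdShift.shiftGroup ZdShift.ledrappier ∧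
    -- the six matrices preserving the elementary `L`-triangles
    (∀ M : Matrix.GeneralLinearGroup (Fin 2) ℤ, M ∈ ZdShift.D3 ↔
      M.val ∈ ({!![1, 0; 0, 1], !![0, 1; 1, 0], !![-1, -1; 0, 1],
        !![0, 1; -1, -1], !![1, 0; -1, -1], !![-1, -1; 1, 0]} :
          Set (Matrix (Fin 2) (Fin 2) ℤ))) ∧
    -- they form the dihedral group with six elements, `D₃ ≃ C₃ ⋊ C₂`
    Nat.card ZdShift.D3 = 6 ∧
    Nonempty (ZdShift.D3 ≃* DihedralGroup 3) ∧
    (∃ C₃ C₂ : Subgroup ZdShift.D3, C₃.Normal ∧ IsCyclic C₃ ∧ Nat.card C₃ = 3 ∧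
      IsCyclic C₂ ∧ Nat.card C₂ = 2 ∧ Subgroup.IsComplement' C₃ C₂) ∧
    -- the conjugation action of the extended symmetries on the shifts realises exactly `D₃`
    (∀ M : Matrix.GeneralLinearGroup (Fin 2) ℤ,
      (∃ H ∈ ZdShift.extendedSymmetryGroup ZdShift.ledrappier,
        ZdShift.ConjugatesShiftsBy ZdShift.ledrappier H M) ↔ M ∈ ZdShift.D3) ∧
    -- `ℛ (X) = ℤ² ⋊ D₃`, where `(v, M)` corresponds to `S^v ∘ h_M`
    (∃ Φ : Multiplicative (Fin 2 → ℤ) ⋊[(ZdShift.linearAction 2).comp ZdShift.D3.subtype]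
          ZdShift.D3 ≃* ZdShift.extendedSymmetryGroup ZdShift.ledrappier,
      ∀ (v : Fin 2 → ℤ) (M : ZdShift.D3) (x : ZdShift.Space ZdShift.ledrappier),
        (((Φ ⟨Multiplicative.ofAdd v, M⟩ : ZdShift.AutGroup ZdShift.ledrappier) x :
            ZdShift.Space ZdShift.ledrappier) : ZdShift.Config 2 (ZMod 2)) =
          SymbolicDynamics.FullShift.shift v
            (ZdShift.coordMap (M : Matrix.GeneralLinearGroup (Fin 2) ℤ) x.val)) := by
  refine ⟨ZdShift.shiftHom_ledrappier_injective, ZdShift.symmetryGroup_ledrappier,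
    fun M => ZdShift.mem_D3_iff, ZdShift.card_D3, ZdShift.nonempty_D3_mulEquiv,
    ZdShift.exists_D3_complement, fun M => ⟨fun ⟨H, _, hH⟩ => hH.mem_D3, fun hM => ?_⟩, ?_⟩
  · have h := ZdShift.conjugatesShiftsBy_coordHom ⟨M, hM⟩
    exact ⟨_, h.mem_extendedSymmetryGroup, h⟩
  · exact ⟨(MonoidHom.ofInjective ZdShift.semidirectHom_injective).trans
      (MulEquiv.subgroupCongr ZdShift.range_semidirectHom), fun v M x => rfl⟩
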